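/- **Theorem 1.1 (Unconditioned case).** Let $p_1,q_1,p_2,q_2$ be positive real numbers with $p_1+q_1+p_2+q_2=1$, and put $h_i=p_i+q_i$. Let $(S_n)_{n\ge 0}=(S^1_n,S^2_n)_{n\ge0}$ be the random walk on $\mathbb Z^2$ with $S_0=(0,0)$ and i.i.d. increments $\xi_k=S_k-S_{k-1}$ satisfying $$\mathbb P(\xi_k=(1,0))=p_1,\quad \mathbb P(\xi_k=(-1,0))=q_1,\quad \mathbb P(\xi_k=(0,1))=p_2,\quad \mathbb P(\xi_k=(0,-1))=q_2 .$$ For $i=1,2$ let $N^i_n=\#\{1\le k\le n : S^i_k=0,\ S^i_{k-1}\neq 0\}$, and set $a^i_n=\sqrt{h_i n}$ if $p_i=q_i$ and $a^i_n=1$ if $p_i\neq q_i$. Then, as $n\to\infty$, $$\left(\frac{N^1_n}{a^1_n},\frac{N^2_n}{a^2_n}\right)\Rightarrow (X_1,X_2)$$ in distribution, where $X_1$ and $X_2$ are independent and, for each $i\in\{1,2\}$: * if $p_i=q_i$, then $X_i$ is half-normal, i.e. it takes values in $[0,\infty)$ and has cumulative distribution function $x\mapsto\sqrt{2/\pi}\int_0^x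 e^{-t^2/2}\,dt$ for $x\ge0$; * if $p_i\neq q_i$, then $X_i$ is geometric with parameter $\alpha_i=|p_i-q_i|/h_i$, i.e. $\mathbb P(X_i=k)=\alpha_i(1-\alpha_i)^k$ for $k=0,1,2,\dots$. -/

import Mathlib

open MeasureTheory ProbabilityTheory Filter

noncomputable section

namespace AxisReturns

/-- The half-normal distribution: the law on `[0, ∞)` with density `√(2/π) * exp (-t² / 2)`, so that
its cumulative distribution function is `x ↦ √(2/π) ∫₀ˣ exp (-t² / 2) dt` for `x ≥ 0`. -/
def halfNormal : Measure ℝ :=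
  (volume.restrict (Set.Ici 0)).withDensity
    fun t => ENNReal.ofReal (Real.sqrt (2 / Real.pi) * Real.exp (-t ^ 2 / 2))

/-- The geometric distribution with parameter `α`, carried by `{0, 1, 2, …} ⊆ ℝ`, giving mass
`α * (1 - α) ^ k` to each natural number `k` (for `α ≠ 0`). -/
def geometric (α : unitInterval) : Measure ℝ :=
  (geometricMeasure α).map (fun k : ℕ => (k : ℝ))

/-- The parameter `|p - q| / (p + q)`, which lies in the unit interval. -/
def driftRatio (p q : ℝ) (hp : 0 < p) (hq : 0 < q) : unitInterval :=
  ⟨|p - q| / (p + q), div_nonneg (abs_nonneg _) (add_pos hp hq).le,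
    (div_le_one (add_pos hp hq)).2 (abs_le.2 ⟨by linarith, by linarith⟩)⟩

/-- `ξ 0, ξ 1, …` are the i.i.d. increments of a nearest-neighbour random walk on `ℤ²`
(coordinates indexed by `i : Fin 2`): each step is `e i` with probability `p i` and `-e i` with
probability `q i`, where `e 0 = (1, 0)` and `e 1 = (0, 1)`. Here `ξ k` is the step made from
time `k` to time `k + 1`. -/
structure IsStepSequence {Ω : Type*} [MeasurableSpace Ω] (P : Measure Ω) (p q : Fin 2 → ℝ)
    (ξ : ℕ → Ω → Fin 2 → ℤ) : Prop where
  measurable : ∀ k, Measurable (ξ k)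
  indep : iIndepFun ξ P
  prob_pos : ∀ k i, P.real {ω | ξ k ω = Pi.single i 1} = p i
  prob_neg : ∀ k i, P.real {ω | ξ k ω = -Pi.single i 1} = q i

/-- The position at time `n` of the walk started at the origin with increments `ξ`. -/
def walk {Ω : Type*} (ξ : ℕ → Ω → Fin 2 → ℤ) (n : ℕ) (ω : Ω) : Fin 2 → ℤ :=
  ∑ k ∈ Finset.range n, ξ k ω

/-- The number of strict returns to `0` of the `i`-th coordinate of `S` up to time `n`: times
`1 ≤ k ≤ n` at which this coordinate is `0` while it was nonzero at time `k - 1`. -/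
def returns {Ω : Type*} (S : ℕ → Ω → Fin 2 → ℤ) (i : Fin 2) (n : ℕ) (ω : Ω) : ℕ :=
  ((Finset.Icc 1 n).filter fun k => S k ω i = 0 ∧ S (k - 1) ω i ≠ 0).card

/-- The normalisation `√((p + q) n)` if `p = q`, and `1` otherwise. -/
def scale (p q : ℝ) (n : ℕ) : ℝ :=
  if p = q then Real.sqrt ((p + q) * n) else 1

end AxisReturns

end

/-! Condition on the number `k` of the first `n` steps made along axis 0. The two coordinates are
then independent one-dimensional walks with `k` and `n - k` steps and step probabilities `p i / (p i
+ q i)`, `q i / (p i + q i)`. Since `k` is binomial, `k / n` concentrates at `p 0 + q 0`, so each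
factor may be replaced by its limit, and the limit law is a product.

The conditioning is done algebraically: the planar transition operator is a sum of two commuting
operators, one per axis, and the binomial theorem expands its powers (`planeOp_add_pow_tensor`,
`measureReal_pathState_pi`). Concentration is `tendsto_binomial_average`.

In one dimension, a biased walk at 0 returns with probability `1 - |p - q|`, afresh each time, so
the count is geometric (`tendsto_returnsTail_of_ne`). For the symmetric walk, making `r` returns in
`m` steps is as likely as reaching level `r` in `m - r` steps (`returnsTail_half`); the reflection
principle and the central limit theorem then give the half-normal law (`tendsto_returnsTail_half`).
-/

open scoped Topology

namespace AxisReturns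

noncomputable section

/-! ### Biased walk on the line: geometric limit -/

section

/-- The probability that a nearest-neighbour walk on `ℤ` with up-probability `p` and
down-probability `q`, started at `s`, makes at least `r` strict returns to `0` in `m` steps. -/
def returnsTail (p q : ℝ) : ℕ → ℤ → ℕ → ℝ
  | 0, _, r => if r = 0 then 1 else 0
  | m + 1, s, r =>
      p * returnsTail p q m (s + 1) (if s + 1 = 0 then r - 1 else r) +
        q * returnsTail p q m (s - 1) (if s - 1 = 0 then r - 1 else r)

variable {p q : ℝ}

lemma returnsTail_zero_right (hpq : p + q = 1) (m : ℕ) (s : ℤ) :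
    returnsTail p q m s 0 = 1 := by
  induction m generalizing s with
  | zero => simp [returnsTail]
  | succ m ih => simp [returnsTail, ih, hpq]

lemma returnsTail_nonneg (hp : 0 ≤ p) (hq : 0 ≤ q) (m : ℕ) (s : ℤ) (r : ℕ) :
    0 ≤ returnsTail p q m s r := by
  induction m generalizing s r with
  | zero => simp only [returnsTail]; split_ifs <;> norm_num
  | succ m ih => exact add_nonneg (mul_nonneg hp (ih _ _)) (mul_nonneg hq (ih _ _))

lemma returnsTail_le_one (hp : 0 ≤ p) (hq : 0 ≤ q) (hpq : p + q = 1) (m : ℕ) (s : ℤ) (r : ℕ) :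
    returnsTail p q m s r ≤ 1 := by
  induction m generalizing s r with
  | zero => simp only [returnsTail]; split_ifs <;> norm_num
  | succ m ih =>
    rw [returnsTail, ← hpq]
    exact add_le_add (mul_le_of_le_one_right hp (ih _ _)) (mul_le_of_le_one_right hq (ih _ _))

lemma returnsTail_mono (hp : 0 ≤ p) (hq : 0 ≤ q) (hpq : p + q = 1) (s : ℤ) (r : ℕ) :
    Monotone fun m => returnsTail p q m s r := by
  refine monotone_nat_of_le_succ fun m => ?_
  induction m generalizing s r with
  | zero =>
    rcases eq_or_ne r 0 with rfl | hr
    · simp [returnsTail_zero_right hpq]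
    · simpa [returnsTail, hr] using returnsTail_nonneg hp hq 1 s r
  | succ m ih =>
    rw [returnsTail, returnsTail]
    exact add_le_add (mul_le_mul_of_nonneg_left (ih _ _) hp)
      (mul_le_mul_of_nonneg_left (ih _ _) hq)

/-- Reflecting the line exchanges the up and down probabilities, so the right-hand side should carry
`q p`: that form fits the closing `add_comm` and the use in `tendsto_returnsTail_of_ne`. As written,
with `p q` on both sides, the identity fails for `p ≠ q`: at `m = 1`, `s = 1`, `r = 1` it reads `p =
q`. -/
lemma returnsTail_neg (m : ℕ) (s : ℤ) (r : ℕ) :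
    returnsTail p q m (-s) r = returnsTail q p m s r := by
  induction m generalizing s r with
  | zero => simp [returnsTail]
  | succ m ih =>
    have h₁ : -s + 1 = -(s - 1) := by ring
    have h₂ : -s - 1 = -(s + 1) := by ring
    simp only [returnsTail, h₁, h₂, ih, neg_eq_zero]
    rw [add_comm]

/-- The supermartingale bound for a walk drifting upwards. -/
lemma returnsTail_le (hp : 0 < p) (hq : 0 ≤ q) (hpq : p + q = 1) (m : ℕ) (r : ℕ) :
    returnsTail p q m 0 r ≤ (2 * q) ^ r ∧
    (∀ s : ℕ, returnsTail p q m (s + 1) (r + 1) ≤ (2 * q) ^ r * (q / p) ^ (s + 1)) ∧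
    ∀ s : ℕ, returnsTail p q m (-(s + 1)) (r + 1) ≤ (2 * q) ^ r := by
  induction m generalizing r with
  | zero =>
    refine ⟨?_, fun s => ?_, fun s => ?_⟩
    · rcases eq_or_ne r 0 with rfl | hr
      · simp [returnsTail]
      · simp only [returnsTail, hr, if_false]; positivity
    · simp only [returnsTail, Nat.succ_ne_zero, if_false]; positivity
    · simp only [returnsTail, Nat.succ_ne_zero, if_false]; positivity
  | succ m ih =>
    refine ⟨?_, fun s => ?_, fun s => ?_⟩
    · rcases r with _ | r
      · simp [returnsTail_zero_right hpq]
      · have h₁ := (ih r).2.1 0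
        have h₂ := (ih r).2.2 0
        simp only [CharP.cast_eq_zero, zero_add, pow_one] at h₁ h₂
        simp only [returnsTail, zero_add, one_ne_zero, if_false, zero_sub, neg_eq_zero]
        calc _ ≤ p * ((2 * q) ^ r * (q / p)) + q * (2 * q) ^ r := by gcongr
          _ = (2 * q) ^ (r + 1) := by field_simp; ring
    · have h₁ := (ih r).2.1 (s + 1)
      push_cast at h₁
      rw [returnsTail, if_neg (by omega)]
      have h₂ : returnsTail p q m (s + 1 - 1) (if (s : ℤ) + 1 - 1 = 0 then r + 1 - 1 else r + 1) ≤
          (2 * q) ^ r * (q / p) ^ s := by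
        rcases s with _ | s
        · simpa using (ih r).1
        · rw [if_neg (by push_cast; omega)]
          have := (ih r).2.1 s
          simpa using this
      calc _ ≤ p * ((2 * q) ^ r * (q / p) ^ (s + 1 + 1)) + q * ((2 * q) ^ r * (q / p) ^ s) := by
            gcongr
        _ = (2 * q) ^ r * (q / p) ^ s * (p * (q / p) * (q / p) + q) := by ring
        _ = (2 * q) ^ r * (q / p) ^ s * (q * (q / p) + p * (q / p)) := by
            rw [mul_div_cancel₀ q hp.ne']
        _ = (2 * q) ^ r * (q / p) ^ s * ((p + q) * (q / p)) := by ring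
        _ = _ := by rw [hpq]; ring
    · have h₁ := (ih r).2.2 (s + 1)
      push_cast at h₁
      rw [returnsTail, if_neg (c := (-((s : ℤ) + 1) - 1 = 0)) (by omega)]
      have h₂ : returnsTail p q m (-(s + 1) + 1)
          (if -((s : ℤ) + 1) + 1 = 0 then r + 1 - 1 else r + 1) ≤ (2 * q) ^ r := by
        rcases s with _ | s
        · simpa using (ih r).1
        · rw [if_neg (by push_cast; omega)]
          have := (ih r).2.2 s
          simpa using this
      have h₃ : -((s : ℤ) + 1) - 1 = -(s + 1 + 1) := by ring
      rw [h₃]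
      calc _ ≤ p * (2 * q) ^ r + q * (2 * q) ^ r := by gcongr
        _ = _ := by rw [← add_mul, hpq, one_mul]

/-- A function on `ℕ` harmonic for an upward walk and vanishing at infinity. -/
lemma harmonic_of_tendsto_zero {f : ℕ → ℝ}
    (hpq : p + q = 1) (hf : ∀ s, f (s + 1) = p * f (s + 2) + q * f s)
    (h0 : Tendsto f atTop (𝓝 0)) : p * f 1 = q * f 0 := by
  -- Harmonicity says that this flux does not depend on `s`; letting `s → ∞` shows that it is 0.
  have inv : ∀ s, p * f (s + 1) - q * f s = p * f 1 - q * f 0 := by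
    intro s
    induction s with
    | zero => rfl
    | succ s ih =>
      rw [← ih]
      have : (p + q) * f (s + 1) = p * f (s + 2) + q * f s := by rw [hpq, one_mul, hf]
      linarith
  have h1 : Tendsto (fun s => p * f (s + 1) - q * f s) atTop (𝓝 (p * 0 - q * 0)) :=
    ((h0.comp (tendsto_add_atTop_nat 1)).const_mul p).sub (h0.const_mul q)
  simp only [inv] at h1
  have := tendsto_nhds_unique h1 tendsto_const_nhds
  linarith

/-- A function on `ℕ` harmonic for a downward walk and bounded by its value at `0`. -/
lemma harmonic_of_le {f : ℕ → ℝ} (hq : 0 < q) (hqp : q ≤ p)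
    (hpq : p + q = 1) (hf : ∀ s, f (s + 1) = q * f (s + 2) + p * f s)
    (hle : ∀ s, f s ≤ f 0) (hnn : ∀ s, 0 ≤ f s) : f 1 = f 0 := by
  -- Each increment is `p / q ≥ 1` times the previous one, so a negative first increment would force
  -- linear decay below 0.
  have grow : ∀ s, f (s + 1) - f s ≤ f 1 - f 0 := by
    intro s
    induction s with
    | zero => rfl
    | succ s ih =>
      have h1 : (p + q) * f (s + 1) = q * f (s + 2) + p * f s := by rw [hpq, one_mul, hf]
      have h2 : q * (f (s + 2) - f (s + 1)) = p * (f (s + 1) - f s) := by linarith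
      have h3 := hle 1
      have h4 : p * (f (s + 1) - f s) ≤ q * (f (s + 1) - f s) :=
        mul_le_mul_of_nonpos_right hqp (by linarith)
      have h5 : q * (f (s + 2) - f (s + 1)) ≤ q * (f (s + 1) - f s) := by linarith
      linarith [le_of_mul_le_mul_left h5 hq]
  have lin : ∀ s : ℕ, f s ≤ f 0 + s * (f 1 - f 0) := by
    intro s
    induction s with
    | zero => simp
    | succ s ih => push_cast; linarith [grow s]
  refine le_antisymm (hle 1) ?_
  by_contra! h
  obtain ⟨s, hs⟩ := exists_nat_gt (f 0 / (f 0 - f 1))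
  rw [div_lt_iff₀ (by linarith)] at hs
  linarith [lin s, hnn s]

/-- The limits in `m` exist by monotonicity and satisfy the one-step equations. From 1 the walk ever
hits 0 with probability `q / p`, from -1 with probability 1; one more return therefore costs the
factor `p * (q / p) + q = 2 * q`. -/
lemma tendsto_returnsTail_of_lt (hq : 0 < q) (hqp : q < p) (hpq : p + q = 1) (r : ℕ) :
    Tendsto (fun m => returnsTail p q m 0 r) atTop (𝓝 ((2 * q) ^ r)) := by
  have hp : 0 < p := hq.trans hqp
  have hlim : ∀ (s : ℤ) (r : ℕ), ∃ v, Tendsto (fun m => returnsTail p q m s r) atTop (𝓝 v) :=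
    fun s r => ⟨_, tendsto_atTop_ciSup (returnsTail_mono hp.le hq.le hpq s r)
      ⟨1, by rintro _ ⟨m, rfl⟩; exact returnsTail_le_one hp.le hq.le hpq m s r⟩⟩
  choose v hv using hlim
  have hrec : ∀ s r, v s r = p * v (s + 1) (if s + 1 = 0 then r - 1 else r) +
      q * v (s - 1) (if s - 1 = 0 then r - 1 else r) := fun s r =>
    tendsto_nhds_unique ((hv s r).comp (tendsto_add_atTop_nat 1))
      (((hv _ _).const_mul p).add ((hv _ _).const_mul q))
  suffices h : v 0 r = (2 * q) ^ r from h ▸ hv 0 r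
  have hnn : ∀ s r, 0 ≤ v s r := fun s r =>
    ge_of_tendsto' (hv s r) fun m => returnsTail_nonneg hp.le hq.le m s r
  induction r with
  | zero =>
    exact tendsto_nhds_unique (hv 0 0) (by simp [returnsTail_zero_right hpq])
  | succ r ih =>
    have hup : ∀ s : ℕ, v (s + 1) (r + 1) ≤ (2 * q) ^ r * (q / p) ^ (s + 1) := fun s =>
      le_of_tendsto' (hv _ _) fun m => (returnsTail_le hp hq.le hpq m r).2.1 s
    have hdown : ∀ s : ℕ, v (-(s + 1)) (r + 1) ≤ (2 * q) ^ r := fun s =>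
      le_of_tendsto' (hv _ _) fun m => (returnsTail_le hp hq.le hpq m r).2.2 s
    have h1 : p * v 1 (r + 1) = q * (2 * q) ^ r := by
      -- The value at 0 is that of `v 0 r`, not `v 0 (r + 1)`: arriving at 0 uses up one return.
      let f : ℕ → ℝ := fun s => if s = 0 then (2 * q) ^ r else v s (r + 1)
      have := harmonic_of_tendsto_zero (p := p) (q := q) (f := f) hpq ?_ ?_
      · simpa [f] using this
      · intro s
        have := hrec (s + 1) (r + 1)
        rw [if_neg (by omega)] at this
        rcases s with _ | s
        · simpa [f, ih, add_assoc, one_add_one_eq_two] using this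
        · rw [if_neg (by push_cast; omega), add_sub_cancel_right] at this
          simpa [f, add_assoc, one_add_one_eq_two] using this
      · have hg : Tendsto (fun s : ℕ => (2 * q) ^ r * (q / p) ^ s) atTop (𝓝 0) := by
          simpa using (tendsto_pow_atTop_nhds_zero_of_lt_one (div_nonneg hq.le hp.le)
            ((div_lt_one hp).2 hqp)).const_mul ((2 * q) ^ r)
        refine squeeze_zero (fun s => ?_) (fun s => ?_) hg
        · simp only [f]; split_ifs
          · positivity
          · exact hnn _ _
        · rcases s with _ | s
          · simp [f]
          · simpa [f] using hup s
    have h2 : v (-1) (r + 1) = (2 * q) ^ r := by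
      let f : ℕ → ℝ := fun s => if s = 0 then (2 * q) ^ r else v (-s) (r + 1)
      have := harmonic_of_le (p := p) (q := q) (f := f) hq hqp.le hpq ?_ ?_ ?_
      · simpa [f] using this
      · intro s
        have := hrec (-(s + 1)) (r + 1)
        rw [if_neg (c := (-((s : ℤ) + 1) - 1 = 0)) (by omega)] at this
        have e : -((s : ℤ) + 1) - 1 = -(s + 2) := by ring
        rw [e] at this
        rcases s with _ | s
        · simpa [f, ih, add_comm] using this
        · have e' : -(((s + 1 : ℕ) : ℤ) + 1) + 1 = -(s + 1) := by push_cast; ring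
          rw [e', if_neg (by omega)] at this
          rw [add_comm (q * _)]
          simpa [f] using this
      · intro s
        rcases s with _ | s
        · simp
        · simpa [f] using hdown s
      · intro s
        simp only [f]; split_ifs
        · positivity
        · exact hnn _ _
    have := hrec 0 (r + 1)
    simp only [zero_add, one_ne_zero, if_false, zero_sub, neg_eq_zero] at this
    rw [this, h1, h2]
    ring

/-- The number of returns of a biased walk is asymptotically geometric. -/
theorem tendsto_returnsTail_of_ne (hp : 0 < p) (hq : 0 < q) (hne : p ≠ q) (hpq : p + q = 1)
    (r : ℕ) : Tendsto (fun m => returnsTail p q m 0 r) atTop (𝓝 ((1 - |p - q|) ^ r)) := by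
  rcases hne.lt_or_gt with h | h
  · have := tendsto_returnsTail_of_lt hp h (by linarith) r
    rw [abs_of_neg (by linarith), show 1 - -(p - q) = 2 * p by linarith]
    refine this.congr fun m => ?_
    rw [← returnsTail_neg, neg_zero]
  · rw [abs_of_pos (by linarith), show 1 - (p - q) = 2 * q by linarith]
    exact tendsto_returnsTail_of_lt hq h hpq r

end

/-! ### Symmetric walk: returns, reflection and the Gaussian limit -/

section

/-- The probability that the simple symmetric random walk on `ℤ` started at `0` is at least `l`
at time `m`. -/
def symmTail : ℕ → ℤ → ℝ
  | 0, l => if l ≤ 0 then 1 else 0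
  | m + 1, l => (symmTail m (l - 1) + symmTail m (l + 1)) / 2

lemma symmTail_antitone (m : ℕ) : Antitone (symmTail m) := by
  induction m with
  | zero =>
    intro a b hab
    simp only [symmTail]
    split_ifs <;> first | omega | norm_num
  | succ m ih =>
    intro a b hab
    have h₁ := ih (sub_le_sub_right hab 1)
    have h₂ := ih (add_le_add_left hab 1)
    simp only [symmTail]
    linarith

lemma symmTail_add_symmTail (m : ℕ) (l : ℤ) : symmTail m l + symmTail m (1 - l) = 1 := by
  induction m generalizing l with
  | zero =>
    simp only [symmTail]
    split_ifs <;> first | omega | norm_num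
  | succ m ih =>
    have h₁ := ih (l - 1)
    have h₂ := ih (l + 1)
    simp only [symmTail]
    rw [show 1 - (l - 1) = 1 - l + 1 by ring] at h₁
    rw [show 1 - (l + 1) = 1 - l - 1 by ring] at h₂
    linarith

/-- The probability that the simple symmetric random walk reaches the level `l ≥ 0` by time `m`,
in the form given by the reflection principle. -/
def reachProb (m : ℕ) (l : ℤ) : ℝ := symmTail m l + symmTail m (l + 1)

lemma reachProb_zero_right (m : ℕ) : reachProb m 0 = 1 := by
  simpa [reachProb] using symmTail_add_symmTail m 0

lemma reachProb_zero_left {l : ℤ} (hl : 0 < l) : reachProb 0 l = 0 := by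
  simp only [reachProb, symmTail]
  rw [if_neg (by omega), if_neg (by omega), add_zero]

/-- As an identity between sums of tails this needs no sign condition on `l`. -/
lemma reachProb_succ (m : ℕ) (l : ℤ) :
    reachProb (m + 1) l = (reachProb m (l + 1) + reachProb m (l - 1)) / 2 := by
  simp only [reachProb, symmTail, sub_add_cancel, add_sub_cancel_right]
  ring

/-- For the simple symmetric random walk, the time of the `r`-th return to `0` has the law of `r`
plus the hitting time of the level `r`. -/
lemma returnsTail_half (m : ℕ) :
    (∀ r : ℕ, returnsTail (1 / 2) (1 / 2) m 0 r = reachProb (m - r) r) ∧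
    ∀ s r : ℕ, returnsTail (1 / 2) (1 / 2) m (s + 1) (r + 1) = reachProb (m - r) (s + 1 + r) := by
  induction m with
  | zero =>
    refine ⟨fun r => ?_, fun s r => ?_⟩
    · rcases r with _ | r
      · simp [returnsTail, reachProb_zero_right]
      · simp only [zero_tsub, returnsTail, Nat.succ_ne_zero, if_false]
        rw [reachProb_zero_left (by omega)]
    · simp only [zero_tsub, returnsTail, Nat.succ_ne_zero, if_false]
      rw [reachProb_zero_left (by omega)]
  | succ m ih =>
    refine ⟨fun r => ?_, fun s r => ?_⟩
    · rcases r with _ | r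
      · rw [returnsTail_zero_right (by norm_num)]
        simp [reachProb_zero_right]
      · have h := ih.2 0 r
        simp only [CharP.cast_eq_zero, zero_add] at h
        -- Both first steps lead to distance 1 from 0. This free step is the unit of time that each
        -- return subtracts from `m`.
        simp only [returnsTail, zero_add, one_ne_zero, if_false, zero_sub, neg_eq_zero,
          returnsTail_neg, h, Nat.add_sub_add_right]
        push_cast
        rw [add_comm (1 : ℤ)]
        ring
    · have h₁ := ih.2 (s + 1) r
      have h₂ : returnsTail (1 / 2) (1 / 2) m (s + 1 - 1)
          (if (s : ℤ) + 1 - 1 = 0 then r + 1 - 1 else r + 1) = reachProb (m - r) (s + r) := by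
        rcases s with _ | s
        · simpa using ih.1 r
        · rw [if_neg (by push_cast; omega), add_sub_cancel_right]
          simpa using ih.2 s r
      push_cast at h₁
      rw [returnsTail, if_neg (by omega), h₁, h₂]
      rcases le_or_gt r m with hrm | hrm
      · rw [Nat.sub_add_comm hrm, reachProb_succ]
        rw [show (s : ℤ) + 1 + 1 + r = s + 1 + r + 1 by ring,
          show (s : ℤ) + 1 + r - 1 = s + r by ring]
        ring
      -- Here the subtraction truncates, harmlessly: all levels involved are positive, so every term
      -- vanishes at time 0.
      · rw [show m - r = 0 by omega, show m + 1 - r = 0 by omega, reachProb_zero_left (by omega),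
          reachProb_zero_left (by omega), reachProb_zero_left (by omega)]
        ring

/-- The upper tail of the standard Gaussian law. -/
def gaussianTail (x : ℝ) : ℝ := (gaussianReal 0 1).real (Set.Ici x)

lemma continuous_gaussianTail : Continuous gaussianTail := by
  have := nullSingletonClass_gaussianReal (μ := 0) (v := 1) one_ne_zero
  refine continuous_iff_continuousAt.2 fun x => ?_
  have h : ContinuousOn (fun b => ∫ _ in Set.Ici b, (1 : ℝ) ∂(gaussianReal 0 1))
      (Set.Ici (x - 1)) := (integrable_const _).integrableOn.continuousOn_Ici_primitive_Ici
  have h' := h.continuousAt (Ici_mem_nhds (by linarith))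
  simpa [gaussianTail] using! h'

/-- The uniform law on `{1, -1}`. -/
def signMeasure : Measure ℤ := (2⁻¹ : ENNReal) • (Measure.dirac 1 + Measure.dirac (-1))

instance : IsProbabilityMeasure signMeasure :=
  ⟨by simp [signMeasure, ENNReal.inv_two_add_inv_two]⟩

lemma signMeasure_real_one : signMeasure.real {1} = 1 / 2 := by
  simp [signMeasure, Measure.real]

lemma signMeasure_real_neg_one : signMeasure.real {-1} = 1 / 2 := by
  simp [signMeasure, Measure.real]

lemma ae_signMeasure : ∀ᵐ x ∂signMeasure, x = 1 ∨ x = -1 := by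
  rw [ae_iff]
  simp [signMeasure]

/-- Total probability over the last step, independent of the past; it drives the recursions for both
the sign walk and the planar walk. -/
lemma measureReal_eq_sum_of_finite_values {Ω β : Type*} [MeasurableSpace Ω] [MeasurableSpace β]
    [MeasurableSingletonClass β] {P : Measure Ω} [IsFiniteMeasure P] {α : Type*}
    [MeasurableSpace α] [DiscreteMeasurableSpace α] {Y : Ω → α} {X : Ω → β}
    (hY : Measurable Y) (hX : Measurable X) (hYX : IndepFun Y X P) {t : Finset β}
    (ht : ∀ᵐ ω ∂P, X ω ∈ t) (C : Set (α × β)) :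
    P.real {ω | (Y ω, X ω) ∈ C} =
      ∑ b ∈ t, P.real {ω | X ω = b} * P.real {ω | (Y ω, b) ∈ C} := by
  have hfib : P.real {ω | (Y ω, X ω) ∈ C} =
      P.real (⋃ b ∈ t, {ω | (Y ω, b) ∈ C} ∩ {ω | X ω = b}) := by
    refine measureReal_congr ?_
    filter_upwards [ht] with ω hω
    refine propext ?_
    change (Y ω, X ω) ∈ C ↔ ω ∈ ⋃ b ∈ t, {ω | (Y ω, b) ∈ C} ∩ {ω | X ω = b}
    simp only [Set.mem_iUnion, Set.mem_inter_iff, Set.mem_ofPred_eq, exists_prop]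
    exact ⟨fun h => ⟨_, hω, h, rfl⟩, fun ⟨b, _, h, hb⟩ => hb ▸ h⟩
  rw [hfib, measureReal_biUnion_finset]
  · refine Finset.sum_congr rfl fun b _ => ?_
    have := hYX.measure_inter_preimage_eq_mul {a | (a, b) ∈ C} {b} (.of_discrete)
      (measurableSet_singleton b)
    simp only [Measure.real, ← ENNReal.toReal_mul]
    rw [mul_comm]
    exact congrArg ENNReal.toReal this
  · intro b _ b' _ hbb'
    refine Set.disjoint_left.2 fun ω h h' => hbb' ?_
    exact h.2.symm.trans h'.2
  · intro b _
    exact (hY (MeasurableSet.of_discrete (s := {a | (a, b) ∈ C}))).inter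
      (hX (measurableSet_singleton b))

lemma measureReal_le_sum_eq_symmTail {Ω : Type*} [MeasurableSpace Ω] {P : Measure Ω}
    [IsProbabilityMeasure P] {X : ℕ → Ω → ℤ} (hX : ∀ k, Measurable (X k))
    (hlaw : ∀ k, HasLaw (X k) signMeasure P) (hind : iIndepFun X P) (m : ℕ) (l : ℤ) :
    P.real {ω | l ≤ ∑ k ∈ Finset.range m, X k ω} = symmTail m l := by
  induction m generalizing l with
  | zero =>
    by_cases h : l ≤ 0 <;> simp [symmTail, h]
  | succ m ih =>
    have hmeas : Measurable fun ω => ∑ k ∈ Finset.range m, X k ω :=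
      Finset.measurable_fun_sum _ fun k _ => hX k
    have hi : IndepFun (fun ω => ∑ k ∈ Finset.range m, X k ω) (X m) P := by
      convert hind.indepFun_finsetSum_of_notMem hX (s := Finset.range m) (i := m) (by simp) using 1
      ext ω; simp
    have h1 : P.real {ω | X m ω = 1} = 1 / 2 := by
      rw [← signMeasure_real_one]
      exact (hlaw m).measureReal_eq (p := fun x => x = 1) (.of_discrete)
    have h2 : P.real {ω | X m ω = -1} = 1 / 2 := by
      rw [← signMeasure_real_neg_one]
      exact (hlaw m).measureReal_eq (p := fun x => x = -1) (.of_discrete)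
    have hae : ∀ᵐ ω ∂P, X m ω ∈ ({1, -1} : Finset ℤ) := by
      have := ((hlaw m).ae_iff (p := fun x => x = 1 ∨ x = -1) (.of_discrete)).2 ae_signMeasure
      simpa using this
    have := measureReal_eq_sum_of_finite_values hmeas (hX m) hi hae {z | l ≤ z.1 + z.2}
    simp only [Set.mem_ofPred_eq] at this
    simp only [Finset.sum_range_succ, this]
    rw [Finset.sum_pair (by norm_num), h1, h2]
    have e1 : ∀ ω, (l ≤ ∑ k ∈ Finset.range m, X k ω + 1) ↔
        l - 1 ≤ ∑ k ∈ Finset.range m, X k ω := fun ω => by omega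
    have e2 : ∀ ω, (l ≤ ∑ k ∈ Finset.range m, X k ω + -1) ↔
        l + 1 ≤ ∑ k ∈ Finset.range m, X k ω := fun ω => by omega
    simp only [e1, e2, ih, symmTail]
    ring

lemma tendsto_symmTail_ceil (y : ℝ) :
    Tendsto (fun m : ℕ => symmTail m ⌈y * √m⌉) atTop (𝓝 (gaussianTail y)) := by
  obtain ⟨Ω, _, P, X, hX, hlaw, hind, hP⟩ := exists_iid ℕ signMeasure
  have hlaw' : ∀ k, HasLaw (fun ω => (X k ω : ℝ)) (signMeasure.map (Int.cast : ℤ → ℝ)) P :=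
    fun k => HasLaw.fun_comp (Y := (Int.cast : ℤ → ℝ))
      ⟨Measurable.aemeasurable .of_discrete, rfl⟩ (hlaw k)
  have hae : ∀ᵐ ω ∂P, X 0 ω = 1 ∨ X 0 ω = -1 :=
    ((hlaw 0).ae_iff (p := fun x => x = 1 ∨ x = -1) (.of_discrete)).2 ae_signMeasure
  have hint : ∀ a : ℤ, Integrable (fun x : ℤ => (x : ℝ)) (Measure.dirac a) := fun a =>
    integrable_dirac (by simp)
  have h0 : ∫ ω, (X 0 ω : ℝ) ∂P = 0 := by
    have := (hlaw 0).integral_comp (f := fun x : ℤ => (x : ℝ))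
      (Measurable.aestronglyMeasurable .of_discrete)
    refine this.trans ?_
    rw [signMeasure, integral_smul_measure, integral_add_measure (hint _) (hint _)]
    simp
  have h1 : ∫ ω, ((fun ω => (X 0 ω : ℝ)) ^ 2) ω ∂P = 1 := by
    have : (fun ω => ((fun ω => (X 0 ω : ℝ)) ^ 2) ω) =ᵐ[P] fun _ => 1 := by
      filter_upwards [hae] with ω hω
      rcases hω with h | h <;> simp [h]
    rw [integral_congr_ae this]
    simp
  have clt := tendstoInDistribution_inv_sqrt_mul_sum (P := P) (X := fun k ω => (X k ω : ℝ))
    (HasLaw.id (μ := gaussianReal 0 1)) h0 h1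
    (hind.comp (fun _ => (Int.cast : ℤ → ℝ)) fun _ => .of_discrete)
    (fun k => ⟨(hlaw' k).aemeasurable, (hlaw' 0).aemeasurable,
      (hlaw' k).map_eq.trans (hlaw' 0).map_eq.symm⟩)
  have := nullSingletonClass_gaussianReal (μ := 0) (v := 1) one_ne_zero
  have key := ProbabilityMeasure.tendsto_measure_of_null_frontier_of_tendsto' clt.tendsto
    (E := Set.Ici y) (by simp)
  have key' := (ENNReal.tendsto_toReal (by simp)).comp key
  simp only [Measure.map_id, ProbabilityMeasure.coe_mk] at key'
  refine key'.congr' ?_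
  filter_upwards [eventually_gt_atTop 0] with m hm
  rw [← measureReal_le_sum_eq_symmTail hX hlaw hind, Function.comp_apply,
    Measure.map_apply_of_aemeasurable (clt.forall_aemeasurable m) measurableSet_Ici, Measure.real]
  congr 2
  ext ω
  have hm' : 0 < √(m : ℝ) := Real.sqrt_pos.2 (by exact_mod_cast hm)
  simp only [Set.mem_preimage, Set.mem_Ici, Set.mem_ofPred_eq, Int.ceil_le]
  push_cast
  rw [inv_mul_eq_div, le_div_iff₀ hm']

/-- The tail is monotone in the level, so moving levels are compared with `⌈y * √k⌉` for fixed `y`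
on either side of `x`; continuity of the Gaussian tail closes the gap. -/
lemma tendsto_symmTail {ι : Type*} {𝓕 : Filter ι} {k : ι → ℕ} {l : ι → ℤ} {x : ℝ}
    (hk : Tendsto k 𝓕 atTop) (hl : Tendsto (fun i => (l i : ℝ) / √(k i)) 𝓕 (𝓝 x)) :
    Tendsto (fun i => symmTail (k i) (l i)) 𝓕 (𝓝 (gaussianTail x)) := by
  have hpos : ∀ᶠ i in 𝓕, 0 < √(k i : ℝ) := by
    filter_upwards [hk.eventually_gt_atTop 0] with i hi
    exact Real.sqrt_pos.2 (by exact_mod_cast hi)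
  refine tendsto_order.2 ⟨fun c hc => ?_, fun c hc => ?_⟩
  · obtain ⟨y, hyx, hy⟩ : ∃ y, x < y ∧ c < gaussianTail y :=
      (((continuous_gaussianTail.tendsto x).mono_left
        (nhdsWithin_le_nhds (s := Set.Ioi x))).eventually_const_lt hc
        |>.and self_mem_nhdsWithin).exists.imp fun y h => ⟨h.2, h.1⟩
    filter_upwards [hpos, hl.eventually_lt_const hyx,
      ((tendsto_symmTail_ceil y).comp hk).eventually_const_lt hy] with i hi hli hci
    refine hci.trans_le (symmTail_antitone _ ?_)
    rw [div_lt_iff₀ hi] at hli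
    exact_mod_cast hli.le.trans (Int.le_ceil _)
  · obtain ⟨y, hyx, hy⟩ : ∃ y, y < x ∧ gaussianTail y < c :=
      (((continuous_gaussianTail.tendsto x).mono_left
        (nhdsWithin_le_nhds (s := Set.Iio x))).eventually_lt_const hc
        |>.and self_mem_nhdsWithin).exists.imp fun y h => ⟨h.2, h.1⟩
    filter_upwards [hpos, hl.eventually_const_lt hyx,
      ((tendsto_symmTail_ceil y).comp hk).eventually_lt_const hy] with i hi hli hci
    refine (symmTail_antitone _ ?_).trans_lt hci
    rw [lt_div_iff₀ hi] at hli
    exact Int.ceil_le.2 hli.le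

/-- The number of returns of the simple symmetric random walk, divided by the square root of the
number of steps, is asymptotically half-normal. -/
theorem tendsto_returnsTail_half {ι : Type*} {𝓕 : Filter ι} {k r : ι → ℕ} {x : ℝ}
    (hk : Tendsto k 𝓕 atTop) (hr : Tendsto (fun i => (r i : ℝ) / √(k i)) 𝓕 (𝓝 x)) :
    Tendsto (fun i => returnsTail (1 / 2) (1 / 2) (k i) 0 (r i)) 𝓕
      (𝓝 (2 * gaussianTail x)) := by
  have hkR : Tendsto (fun i => (k i : ℝ)) 𝓕 atTop := tendsto_natCast_atTop_atTop.comp hk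
  have hsq : Tendsto (fun i => √(k i : ℝ)) 𝓕 atTop := Real.tendsto_sqrt_atTop.comp hkR
  have hpos : ∀ᶠ i in 𝓕, (0 : ℝ) < k i := hkR.eventually_gt_atTop 0
  -- As `r` is of order at most `√k`, the time lost in `k - r` is negligible.
  have hrk : Tendsto (fun i => (r i : ℝ) / k i) 𝓕 (𝓝 0) := by
    have := hr.mul (tendsto_inv_atTop_zero.comp hsq)
    rw [mul_zero] at this
    refine this.congr fun i => ?_
    rw [Function.comp_apply, ← div_eq_mul_inv, div_div, Real.mul_self_sqrt (Nat.cast_nonneg _)]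
  have hlt : ∀ᶠ i in 𝓕, r i < k i := by
    filter_upwards [hrk.eventually_lt_const one_pos, hpos] with i h h0
    rw [div_lt_one h0] at h
    exact_mod_cast h
  have hfrac : Tendsto (fun i => ((k i - r i : ℕ) : ℝ) / k i) 𝓕 (𝓝 1) := by
    have := hrk.const_sub 1
    rw [sub_zero] at this
    refine this.congr' ?_
    filter_upwards [hlt, hpos] with i h h0
    rw [Nat.cast_sub h.le, sub_div, div_self h0.ne']
  have hd : Tendsto (fun i => k i - r i) 𝓕 atTop := by
    rw [← tendsto_natCast_atTop_iff (R := ℝ)]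
    refine (hfrac.pos_mul_atTop one_pos hkR).congr' ?_
    filter_upwards [hpos] with i h0
    exact div_mul_cancel₀ _ h0.ne'
  have hrd : Tendsto (fun i => (r i : ℝ) / √((k i - r i : ℕ) : ℝ)) 𝓕 (𝓝 x) := by
    have := hr.div ((Real.continuous_sqrt.tendsto 1).comp hfrac) (by simp)
    rw [Real.sqrt_one, div_one] at this
    refine this.congr' ?_
    filter_upwards [hpos, hlt] with i h0 h1
    have h2 : (0 : ℝ) < (k i - r i : ℕ) := by exact_mod_cast Nat.sub_pos_of_lt h1
    have h3 := Real.sqrt_pos.2 h0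
    have h4 := Real.sqrt_pos.2 h2
    simp only [Pi.div_apply, Function.comp_apply, Real.sqrt_div h2.le]
    field_simp
  have hrd' : Tendsto (fun i => ((r i : ℝ) + 1) / √((k i - r i : ℕ) : ℝ)) 𝓕 (𝓝 x) := by
    have := hrd.add (tendsto_inv_atTop_zero.comp (Real.tendsto_sqrt_atTop.comp
      (tendsto_natCast_atTop_atTop.comp hd)))
    rw [add_zero] at this
    refine this.congr fun i => ?_
    simp only [Function.comp_apply]
    ring
  rw [two_mul]
  have h₁ := tendsto_symmTail (l := fun i => (r i : ℤ)) hd (by simpa using hrd)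
  have h₂ := tendsto_symmTail (l := fun i => (r i : ℤ) + 1) hd (by simpa using hrd')
  exact (h₁.add h₂).congr fun i => ((returnsTail_half (k i)).1 (r i)).symm

end

/-! ### Binomial concentration and the limit laws -/

section

/-- The filter of pairs `(n, k)` with `n → ∞` and `k / n → h`. -/
def ratioFilter (h : ℝ) : Filter (ℕ × ℕ) :=
  ((atTop : Filter ℕ) ×ˢ 𝓝 h).comap fun z => (z.1, (z.2 : ℝ) / z.1)

lemma tendsto_fst_ratioFilter (h : ℝ) : Tendsto Prod.fst (ratioFilter h) atTop := by
  have := tendsto_fst.comp (tendsto_comap (f := fun z : ℕ × ℕ => (z.1, (z.2 : ℝ) / z.1))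
    (x := (atTop : Filter ℕ) ×ˢ 𝓝 h))
  exact this

lemma tendsto_div_ratioFilter (h : ℝ) :
    Tendsto (fun z : ℕ × ℕ => (z.2 : ℝ) / z.1) (ratioFilter h) (𝓝 h) :=
  tendsto_snd.comp (tendsto_comap (f := fun z : ℕ × ℕ => (z.1, (z.2 : ℝ) / z.1)))

lemma tendsto_snd_ratioFilter {h : ℝ} (hh : 0 < h) :
    Tendsto Prod.snd (ratioFilter h) atTop := by
  rw [← tendsto_natCast_atTop_iff (R := ℝ)]
  have h1 : Tendsto (fun z : ℕ × ℕ => (z.1 : ℝ)) (ratioFilter h) atTop :=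
    tendsto_natCast_atTop_atTop.comp (tendsto_fst_ratioFilter h)
  refine ((tendsto_div_ratioFilter h).pos_mul_atTop hh h1).congr' ?_
  filter_upwards [h1.eventually_gt_atTop 0] with z hz
  exact div_mul_cancel₀ _ hz.ne'

lemma tendsto_sub_ratioFilter {h : ℝ} (hh : h < 1) :
    Tendsto (fun z : ℕ × ℕ => (z.1, z.1 - z.2)) (ratioFilter h) (ratioFilter (1 - h)) := by
  refine tendsto_comap_iff.2 ((tendsto_fst_ratioFilter h).prodMk ?_)
  refine ((tendsto_div_ratioFilter h).const_sub 1).congr' ?_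
  filter_upwards [(tendsto_fst_ratioFilter h).eventually_gt_atTop 0,
    (tendsto_div_ratioFilter h).eventually_lt_const hh] with z hz hlt
  have hz' : (0 : ℝ) < z.1 := by exact_mod_cast hz
  rw [div_lt_one hz'] at hlt
  have hle : z.2 ≤ z.1 := by exact_mod_cast hlt.le
  simp only [Nat.cast_sub hle, sub_div, div_self hz'.ne']

/-- Averages against binomial weights concentrate near the mean. -/
theorem tendsto_binomial_average (h : unitInterval) {g : ℕ × ℕ → ℝ} {L C : ℝ}
    (hC : ∀ z, |g z - L| ≤ C) (hg : Tendsto g (ratioFilter h) (𝓝 L)) :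
    Tendsto (fun n : ℕ => ∑ k ∈ Finset.range (n + 1),
      ((n.choose k : ℝ) * (h : ℝ) ^ k * (1 - (h : ℝ)) ^ (n - k)) * g (n, k)) atTop (𝓝 L) := by
  have hC0 : 0 ≤ C := (abs_nonneg _).trans (hC (0, 0))
  rw [Metric.tendsto_nhds]
  intro ε hε
  have hev : ∀ᶠ z in ratioFilter h, |g z - L| < ε / 2 := by
    simpa [Real.dist_eq] using (Metric.tendsto_nhds.1 hg) (ε / 2) (half_pos hε)
  rw [ratioFilter, eventually_comap] at hev
  obtain ⟨U, hU, V, hV, hUV⟩ := eventually_prod_iff.1 hev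
  obtain ⟨δ, hδ, hδV⟩ := Metric.eventually_nhds_iff.1 hV
  have hsmall : ∀ᶠ n : ℕ in atTop, C / δ ^ 2 / n < ε / 2 :=
    (tendsto_const_div_atTop_nhds_zero_nat _).eventually_lt_const (half_pos hε)
  filter_upwards [hU, hsmall, eventually_gt_atTop 0] with n hnU hn hn0
  -- Chebyshev's argument in pointwise form: the first term covers `k / n` near `h`, the second the
  -- rest, and the binomial variance bounds its average.
  have hpt : ∀ k : ℕ, |g (n, k) - L| ≤ ε / 2 + C / δ ^ 2 * (h - (k : ℝ) / n) ^ 2 := by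
    intro k
    by_cases hk : |(k : ℝ) / n - h| < δ
    · have := hUV hnU (hδV (by rwa [Real.dist_eq])) (n, k) rfl
      have : 0 ≤ C / δ ^ 2 * (h - (k : ℝ) / n) ^ 2 := by positivity
      linarith
    · have h1 : δ ^ 2 ≤ (h - (k : ℝ) / n) ^ 2 := by
        rw [← sq_abs (_ - _), abs_sub_comm]
        exact pow_le_pow_left₀ hδ.le (not_lt.1 hk) 2
      calc _ ≤ C := hC _
        _ = C / δ ^ 2 * δ ^ 2 := by field_simp
        _ ≤ C / δ ^ 2 * (h - (k : ℝ) / n) ^ 2 := by gcongr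
        _ ≤ _ := by linarith
  have hprob := bernstein.probability n h
  have hvar := bernstein.variance hn0.ne' h
  have hw : ∀ k : ℕ, (n.choose k : ℝ) * (h : ℝ) ^ k * (1 - (h : ℝ)) ^ (n - k) = bernstein n k h :=
    fun k => (bernstein_apply n k h).symm
  simp only [hw]
  rw [Finset.sum_range fun k => bernstein n k h * g (n, k), Real.dist_eq]
  have hh : (h : ℝ) * (1 - h) ≤ 1 := mul_le_one₀ h.2.2 (by linarith [h.2.2]) (by linarith [h.2.1])
  calc |∑ k : Fin (n + 1), bernstein n k h * g (n, k) - L|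
      = |∑ k : Fin (n + 1), bernstein n k h * (g (n, k) - L)| := by
        simp only [mul_sub, Finset.sum_sub_distrib, ← Finset.sum_mul, hprob, one_mul]
    _ ≤ ∑ k : Fin (n + 1), |bernstein n k h * (g (n, k) - L)| := Finset.abs_sum_le_sum_abs _ _
    _ ≤ ∑ k : Fin (n + 1), bernstein n k h *
          (ε / 2 + C / δ ^ 2 * (h - (k : ℝ) / n) ^ 2) := by
        refine Finset.sum_le_sum fun k _ => ?_
        rw [abs_mul, abs_of_nonneg bernstein_nonneg]
        exact mul_le_mul_of_nonneg_left (hpt k) bernstein_nonneg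
    _ = ε / 2 + C / δ ^ 2 * ((h : ℝ) * (1 - h) / n) := by
        rw [← hvar, Finset.mul_sum]
        simp only [mul_add, Finset.sum_add_distrib, ← Finset.sum_mul, hprob, one_mul]
        congr 1
        refine Finset.sum_congr rfl fun k _ => ?_
        simp only [bernstein.z]
        ring
    _ ≤ ε / 2 + C / δ ^ 2 / n := by
        rw [← mul_div_assoc]
        gcongr
        exact mul_le_of_le_one_right (by positivity) hh
    _ < ε := by linarith

/-- At least zero returns is certain, so the limit theorem at `r = 0` gives the value. -/
lemma two_mul_gaussianTail_zero : 2 * gaussianTail 0 = 1 := by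
  have := tendsto_returnsTail_half (k := id) (r := fun _ => 0) (x := 0) tendsto_id (by simp)
  simp only [returnsTail_zero_right (by norm_num : (1 / 2 : ℝ) + 1 / 2 = 1)] at this
  exact tendsto_nhds_unique this tendsto_const_nhds

lemma halfNormal_eq : halfNormal = (2 : ENNReal) • (gaussianReal 0 1).restrict (Set.Ici 0) := by
  rw [gaussianReal_of_var_ne_zero 0 one_ne_zero, restrict_withDensity measurableSet_Ici,
    ← withDensity_smul _ (measurable_gaussianPDF 0 1), halfNormal]
  congr 1
  ext t
  simp only [Pi.smul_apply, smul_eq_mul, gaussianPDF, gaussianPDFReal]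
  rw [← ENNReal.ofReal_ofNat 2, ← ENNReal.ofReal_mul zero_le_two, ← mul_assoc]
  congr 2
  · rw [NNReal.coe_one, mul_one, Real.sqrt_div zero_le_two, Real.sqrt_mul zero_le_two]
    have := Real.sqrt_pos.2 Real.pi_pos
    field_simp
    norm_num
  · simp

lemma halfNormal_real_Ici (x : ℝ) :
    halfNormal.real (Set.Ici x) = 2 * gaussianTail (max x 0) := by
  rw [halfNormal_eq, measureReal_ennreal_smul_apply, measureReal_restrict_apply measurableSet_Ici,
    Set.Ici_inter_Ici, gaussianTail]
  rfl

instance : IsProbabilityMeasure halfNormal := by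
  refine ⟨?_⟩
  have h : halfNormal Set.univ = halfNormal (Set.Ici 0) := by
    rw [halfNormal_eq]; simp
  have h' := halfNormal_real_Ici 0
  rw [max_self, two_mul_gaussianTail_zero, Measure.real, ← h] at h'
  exact (ENNReal.toReal_eq_one_iff _).1 h'

instance (α : unitInterval) : IsProbabilityMeasure (geometric α) :=
  Measure.isProbabilityMeasure_map (Measurable.aemeasurable .of_discrete)

lemma geometric_real_Ici {α : unitInterval} (hα : α ≠ 0) (x : ℝ) :
    (geometric α).real (Set.Ici x) = (1 - (α : ℝ)) ^ ⌈x⌉₊ := by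
  have hpre : (fun k : ℕ => (k : ℝ)) ⁻¹' Set.Ici x = (Finset.range ⌈x⌉₊ : Set ℕ)ᶜ := by
    ext k
    simp
  rw [geometric, map_measureReal_apply .of_discrete measurableSet_Ici, hpre,
    probReal_compl_eq_one_sub (.of_discrete), ← sum_measureReal_singleton]
  simp only [geometricMeasure_real_singleton hα]
  induction ⌈x⌉₊ with
  | zero => simp
  | succ n ih => rw [Finset.sum_range_succ, ← sub_sub, ih]; ring

/-- The limit law of the normalised number of returns along one axis. -/
def limitLaw (p q : ℝ) (hp : 0 < p) (hq : 0 < q) : Measure ℝ :=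
  open Classical in if p = q then halfNormal else geometric (driftRatio p q hp hq)

instance (p q : ℝ) (hp : 0 < p) (hq : 0 < q) : IsProbabilityMeasure (limitLaw p q hp hq) := by
  unfold limitLaw; split_ifs <;> infer_instance

theorem tendsto_returnsTail_ratioFilter {p q : ℝ} (hp : 0 < p) (hq : 0 < q) (a : ℝ) :
    Tendsto (fun z : ℕ × ℕ =>
        returnsTail (p / (p + q)) (q / (p + q)) z.2 0 ⌈a * scale p q z.1⌉₊)
      (ratioFilter (p + q)) (𝓝 ((limitLaw p q hp hq).real (Set.Ici a))) := by
  have hh : 0 < p + q := add_pos hp hq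
  have hk := tendsto_snd_ratioFilter hh
  have h1 : p / (p + q) + q / (p + q) = 1 := by rw [← add_div, div_self hh.ne']
  by_cases hpq : p = q
  · subst hpq
    rw [limitLaw, if_pos rfl, halfNormal_real_Ici]
    simp only [scale, if_true]
    rw [show p / (p + p) = 1 / 2 by field_simp; ring]
    refine tendsto_returnsTail_half hk ?_
    have hn : Tendsto (fun z : ℕ × ℕ => (z.1 : ℝ)) (ratioFilter (p + p)) atTop :=
      tendsto_natCast_atTop_atTop.comp (tendsto_fst_ratioFilter _)
    have hs : Tendsto (fun z : ℕ × ℕ => √((p + p) * z.1)) (ratioFilter (p + p)) atTop :=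
      Real.tendsto_sqrt_atTop.comp (hn.const_mul_atTop hh)
    have hceil : Tendsto (fun z : ℕ × ℕ => (⌈a * √((p + p) * z.1)⌉₊ : ℝ) / √((p + p) * z.1))
        (ratioFilter (p + p)) (𝓝 (max a 0)) := by
      rcases le_total 0 a with ha | ha
      · rw [max_eq_left ha]
        exact (tendsto_nat_ceil_mul_div_atTop ha).comp hs
      -- For `a ≤ 0` the natural ceiling is 0, matching the absence of mass below 0.
      · rw [max_eq_right ha]
        refine tendsto_const_nhds.congr fun z => ?_
        rw [Nat.ceil_eq_zero.2 (mul_nonpos_of_nonpos_of_nonneg ha (Real.sqrt_nonneg _)),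
          Nat.cast_zero, zero_div]
    -- This factor trades the normalisation `√((p + p) * n)` for `√k`.
    have hq : Tendsto (fun z : ℕ × ℕ => √((p + p) / ((z.2 : ℝ) / z.1))) (ratioFilter (p + p))
        (𝓝 1) := by
      have := (Real.continuous_sqrt.tendsto _).comp
        ((tendsto_const_nhds (x := p + p)).div (tendsto_div_ratioFilter (p + p)) hh.ne')
      rwa [div_self hh.ne', Real.sqrt_one] at this
    have := hceil.mul hq
    rw [mul_one] at this
    refine this.congr' ?_
    filter_upwards [hs.eventually_gt_atTop 0] with z hz
    rw [div_div_eq_mul_div, Real.sqrt_div' _ (Nat.cast_nonneg _),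
      div_mul_div_cancel₀ hz.ne']
  · have hα : driftRatio p q hp hq ≠ 0 := by
      intro h
      have : |p - q| / (p + q) = 0 := congrArg Subtype.val h
      rw [div_eq_zero_iff, abs_eq_zero, sub_eq_zero] at this
      exact this.elim hpq hh.ne'
    rw [limitLaw, if_neg hpq, geometric_real_Ici hα]
    simp only [scale, if_neg hpq, mul_one]
    have := (tendsto_returnsTail_of_ne (div_pos hp hh) (div_pos hq hh)
      (fun h => hpq ((div_left_inj' hh.ne').1 h)) h1 ⌈a⌉₊).comp hk
    rw [← sub_div, abs_div, abs_of_pos hh] at this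
    exact this

end

/-! ### Planar walk: splitting the transition operator by axis -/

section

/-- The effect of a step `σ` on the pair (position, number of strict returns) of one coordinate. -/
def stepState (σ : ℤ) (z : ℤ × ℕ) : ℤ × ℕ :=
  (z.1 + σ, if z.1 + σ = 0 ∧ z.1 ≠ 0 then z.2 + 1 else z.2)

lemma stepState_zero (z : ℤ × ℕ) : stepState 0 z = z := by
  ext <;> simp +contextual [stepState]

/-- The (weighted) transition operator of one coordinate. -/
def axisOp (p q : ℝ) : Module.End ℝ (ℤ × ℕ → ℝ) where
  toFun f z := p * f (stepState 1 z) + q * f (stepState (-1) z)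
  map_add' f g := by ext z; simp only [Pi.add_apply]; ring
  map_smul' c f := by ext z; simp only [Pi.smul_apply, smul_eq_mul, RingHom.id_apply]; ring

lemma axisOp_apply (p q : ℝ) (f : ℤ × ℕ → ℝ) (z : ℤ × ℕ) :
    axisOp p q f z = p * f (stepState 1 z) + q * f (stepState (-1) z) := rfl

lemma axisOp_pow_indicator (p q : ℝ) (m r : ℕ) (z : ℤ × ℕ) :
    (axisOp p q ^ m) (Set.indicator {z | r ≤ z.2} 1) z = returnsTail p q m z.1 (r - z.2) := by
  induction m generalizing z with
  | zero =>
    simp [returnsTail, Set.indicator_apply, Nat.sub_eq_zero_iff_le]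
  | succ m ih =>
    have h1 : r - (stepState 1 z).2 = if z.1 + 1 = 0 then r - z.2 - 1 else r - z.2 := by
      simp only [stepState]
      split_ifs <;> omega
    have h2 : r - (stepState (-1) z).2 = if z.1 - 1 = 0 then r - z.2 - 1 else r - z.2 := by
      simp only [stepState]
      split_ifs <;> omega
    rw [pow_succ', Module.End.mul_apply, axisOp_apply, ih, ih, h1, h2, returnsTail]
    rfl

/-- With `h = p + q` this normalises the steps along one axis; the factors `h ^ m` become the
binomial weights. -/
lemma axisOp_pow_eq_smul {p q h : ℝ} (hh : h ≠ 0) (m : ℕ) :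
    axisOp p q ^ m = h ^ m • axisOp (p / h) (q / h) ^ m := by
  have : axisOp p q = h • axisOp (p / h) (q / h) := by
    ext f z
    simp only [LinearMap.smul_apply, Pi.smul_apply, smul_eq_mul, axisOp_apply]
    field_simp
  rw [this, smul_pow]

/-- The transition operator of the `i`-th coordinate acting on functions of both coordinates. -/
def planeOp (i : Fin 2) (p q : ℝ) : Module.End ℝ ((Fin 2 → ℤ × ℕ) → ℝ) where
  toFun f z := p * f (Function.update z i (stepState 1 (z i))) +
    q * f (Function.update z i (stepState (-1) (z i)))
  map_add' f g := by ext z; simp only [Pi.add_apply]; ring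
  map_smul' c f := by ext z; simp only [Pi.smul_apply, smul_eq_mul, RingHom.id_apply]; ring

lemma planeOp_apply (i : Fin 2) (p q : ℝ) (f : (Fin 2 → ℤ × ℕ) → ℝ) (z : Fin 2 → ℤ × ℕ) :
    planeOp i p q f z = p * f (Function.update z i (stepState 1 (z i))) +
      q * f (Function.update z i (stepState (-1) (z i))) := rfl

lemma commute_planeOp (p q p' q' : ℝ) : Commute (planeOp 0 p q) (planeOp 1 p' q') := by
  ext f z
  have h (a b : ℤ × ℕ) := Function.update_comm (show (0 : Fin 2) ≠ 1 by decide) a b z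
  simp only [Module.End.mul_apply, planeOp_apply, ne_eq, one_ne_zero, zero_ne_one,
    not_false_eq_true, Function.update_of_ne, h]
  ring

/-- The function `z ↦ f (z 0) * g (z 1)`. -/
def tensor (f g : ℤ × ℕ → ℝ) (z : Fin 2 → ℤ × ℕ) : ℝ := f (z 0) * g (z 1)

lemma planeOp_zero_pow_tensor (p q : ℝ) (m : ℕ) (f g : ℤ × ℕ → ℝ) :
    (planeOp 0 p q ^ m) (tensor f g) = tensor ((axisOp p q ^ m) f) g := by
  induction m with
  | zero => rfl
  | succ m ih =>
    rw [pow_succ', pow_succ', Module.End.mul_apply, Module.End.mul_apply, ih]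
    ext z
    simp only [planeOp_apply, tensor, axisOp_apply, Function.update_self, ne_eq, one_ne_zero,
      not_false_eq_true, Function.update_of_ne]
    ring

lemma planeOp_one_pow_tensor (p q : ℝ) (m : ℕ) (f g : ℤ × ℕ → ℝ) :
    (planeOp 1 p q ^ m) (tensor f g) = tensor f ((axisOp p q ^ m) g) := by
  induction m with
  | zero => rfl
  | succ m ih =>
    rw [pow_succ', pow_succ', Module.End.mul_apply, Module.End.mul_apply, ih]
    ext z
    simp only [planeOp_apply, tensor, axisOp_apply, Function.update_self, ne_eq, zero_ne_one,
      not_false_eq_true, Function.update_of_ne]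
    ring

/-- The operators commute because they act on different coordinates; `k` counts the steps along axis
0. -/
lemma planeOp_add_pow_tensor (p q : Fin 2 → ℝ) (n : ℕ) (f g : ℤ × ℕ → ℝ) (z : Fin 2 → ℤ × ℕ) :
    ((planeOp 0 (p 0) (q 0) + planeOp 1 (p 1) (q 1)) ^ n) (tensor f g) z =
      ∑ k ∈ Finset.range (n + 1), (n.choose k : ℝ) *
        ((axisOp (p 0) (q 0) ^ k) f (z 0) * (axisOp (p 1) (q 1) ^ (n - k)) g (z 1)) := by
  rw [(commute_planeOp _ _ _ _).add_pow, LinearMap.sum_apply, Finset.sum_apply]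
  refine Finset.sum_congr rfl fun k _ => ?_
  rw [← (Nat.cast_commute (n.choose k) _).eq, Module.End.mul_apply, Module.End.mul_apply,
    planeOp_one_pow_tensor, planeOp_zero_pow_tensor, Module.End.natCast_apply]
  simp [tensor]

/-- The pair (position, number of strict returns) of both coordinates after `n` steps. -/
def pathState (x : ℕ → Fin 2 → ℤ) : ℕ → Fin 2 → ℤ × ℕ
  | 0 => 0
  | n + 1 => fun i => stepState (x n i) (pathState x n i)

lemma pathState_congr {x y : ℕ → Fin 2 → ℤ} {n : ℕ} (h : ∀ k < n, x k = y k) :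
    pathState x n = pathState y n := by
  induction n with
  | zero => rfl
  | succ n ih =>
    rw [pathState, pathState, ih fun k hk => h k (hk.trans n.lt_succ_self), h n n.lt_succ_self]

lemma pathState_eq {Ω : Type*} (ξ : ℕ → Ω → Fin 2 → ℤ) (n : ℕ) (ω : Ω) (i : Fin 2) :
    pathState (fun k => ξ k ω) n i = (walk ξ n ω i, returns (walk ξ) i n ω) := by
  induction n with
  | zero => simp [pathState, walk, returns, Prod.ext_iff]
  | succ n ih =>
    have hw : walk ξ (n + 1) ω i = walk ξ n ω i + ξ n ω i := by
      simp [walk, Finset.sum_range_succ]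
    simp only [pathState, ih, stepState, hw, Prod.mk.injEq]
    refine ⟨trivial, ?_⟩
    simp only [returns]
    rw [← Finset.insert_Icc_right_eq_Icc_add_one (by omega), Finset.filter_insert, add_tsub_cancel_right,
      hw]
    split_ifs with hc
    · rw [Finset.card_insert_of_notMem (by simp)]
    · rfl

variable {Ω : Type*} [MeasurableSpace Ω] {P : Measure Ω}
  {p q : Fin 2 → ℝ} {ξ : ℕ → Ω → Fin 2 → ℤ}

lemma measurable_pathState (hξ : ∀ k, Measurable (ξ k)) (n : ℕ) :
    Measurable fun ω => pathState (fun k => ξ k ω) n := by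
  induction n with
  | zero => exact measurable_const
  | succ n ih =>
    exact (Measurable.of_discrete (f := fun y : (Fin 2 → ℤ) × (Fin 2 → ℤ × ℕ) =>
      fun i => stepState (y.1 i) (y.2 i))).comp ((hξ n).prodMk ih)

lemma indepFun_pathState (hξ : ∀ k, Measurable (ξ k)) (hind : iIndepFun ξ P) (n : ℕ) :
    IndepFun (fun ω => pathState (fun k => ξ k ω) n) (ξ n) P := by
  have h := hind.indepFun_finset (Finset.range n) {n} (by simp) hξ
  have h' := h.comp
    -- Only the steps before time `n` matter, so the missing ones may be set to 0.
    (φ := fun x => pathState (fun k => if hk : k ∈ Finset.range n then x ⟨k, hk⟩ else 0) n)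
    (ψ := fun x => x ⟨n, Finset.mem_singleton_self n⟩) (.of_discrete) (.of_discrete)
  have hn : (fun ω => pathState (fun k => ξ k ω) n) =
      (fun x => pathState (fun k => if hk : k ∈ Finset.range n then x ⟨k, hk⟩ else 0) n) ∘
        fun ω (i : Finset.range n) => ξ i ω :=
    funext fun ω => pathState_congr fun k hk => by simp [hk]
  rw [hn]
  exact h'

variable [IsProbabilityMeasure P]

/-- The possible steps of the walk. -/
def stepSet : Finset (Fin 2 → ℤ) :=
  {Pi.single 0 1, -Pi.single 0 1, Pi.single 1 1, -Pi.single 1 1}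

lemma sum_stepSet (F : (Fin 2 → ℤ) → ℝ) :
    ∑ b ∈ stepSet, F b = F (Pi.single 0 1) + (F (-Pi.single 0 1) +
      (F (Pi.single 1 1) + F (-Pi.single 1 1))) := by
  rw [stepSet, Finset.sum_insert (by decide), Finset.sum_insert (by decide),
    Finset.sum_pair (by decide)]

lemma IsStepSequence.ae_mem_stepSet (hξ : IsStepSequence P p q ξ)
    (hsum : ∑ i, (p i + q i) = 1) (k : ℕ) : ∀ᵐ ω ∂P, ξ k ω ∈ stepSet := by
  have h := sum_measureReal_preimage_singleton (μ := P) (f := ξ k) stepSet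
    fun b _ => hξ.measurable k (measurableSet_singleton b)
  have h0 : ∀ b, P.real (ξ k ⁻¹' {b}) = P.real {ω | ξ k ω = b} := fun _ => rfl
  rw [sum_stepSet] at h
  simp only [h0, hξ.prob_pos, hξ.prob_neg] at h
  rw [Fin.sum_univ_two] at hsum
  have h1 : P.real (ξ k ⁻¹' (stepSet : Set (Fin 2 → ℤ))) = 1 := by rw [← h]; linarith
  exact (mem_ae_iff_prob_eq_one (hξ.measurable k .of_discrete)).2
    ((ENNReal.toReal_eq_one_iff _).1 h1)

lemma update_stepState (i : Fin 2) (σ : ℤ) (z : Fin 2 → ℤ × ℕ) :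
    (fun j => stepState ((Pi.single i σ : Fin 2 → ℤ) j) (z j)) =
      Function.update z i (stepState σ (z i)) := by
  ext1 j
  rcases eq_or_ne j i with rfl | h
  · simp
  · simp [h, stepState_zero]

/-- The law of the pair of coordinates is given by the powers of the transition operator. -/
lemma measureReal_pathState (hξ : IsStepSequence P p q ξ) (hsum : ∑ i, (p i + q i) = 1) (n : ℕ)
    (C : Set (Fin 2 → ℤ × ℕ)) :
    P.real {ω | pathState (fun k => ξ k ω) n ∈ C} =
      ((planeOp 0 (p 0) (q 0) + planeOp 1 (p 1) (q 1)) ^ n) (C.indicator 1) 0 := by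
  induction n generalizing C with
  | zero =>
    by_cases h : (0 : Fin 2 → ℤ × ℕ) ∈ C <;> simp [pathState, h]
  | succ n ih =>
    let stepPre (b : Fin 2 → ℤ) : Set (Fin 2 → ℤ × ℕ) := {z | (fun i => stepState (b i) (z i)) ∈ C}
    have h := measureReal_eq_sum_of_finite_values (measurable_pathState hξ.measurable n)
      (hξ.measurable n) (indepFun_pathState hξ.measurable hξ.indep n)
      (hξ.ae_mem_stepSet hsum n) {y | y.1 ∈ stepPre y.2}
    have hb : ∀ b, P.real {ω | pathState (fun k => ξ k ω) n ∈ stepPre b} = _ :=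
      fun b => ih (stepPre b)
    have hpre : ∀ b z, (stepPre b).indicator (1 : (Fin 2 → ℤ × ℕ) → ℝ) z =
        C.indicator 1 (fun i => stepState (b i) (z i)) := fun b z => by
      classical simp [Set.indicator_apply, stepPre]
    -- The operator averages the pullbacks of `C` under the four steps, so the induction hypothesis
    -- applies to each pullback.
    have hop : (planeOp 0 (p 0) (q 0) + planeOp 1 (p 1) (q 1)) (C.indicator 1) =
        p 0 • (stepPre (Pi.single 0 1)).indicator 1 +
        (q 0 • (stepPre (-Pi.single 0 1)).indicator 1 +
        (p 1 • (stepPre (Pi.single 1 1)).indicator 1 +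
        q 1 • (stepPre (-Pi.single 1 1)).indicator 1)) := by
      ext z
      simp only [LinearMap.add_apply, Pi.add_apply, planeOp_apply, Pi.smul_apply, smul_eq_mul,
        hpre, ← Pi.single_neg, update_stepState]
      ring
    calc _ = _ := h
      _ = _ := by
        simp only [Set.mem_ofPred_eq, hb]
        rw [sum_stepSet]
        simp only [hξ.prob_pos, hξ.prob_neg]
        rw [pow_succ, Module.End.mul_apply, hop]
        simp only [map_add, map_smul, Pi.add_apply, Pi.smul_apply, smul_eq_mul]

/-- The joint law of the two return counts is a binomial mixture of products. -/
lemma measureReal_pathState_pi (hp : ∀ i, 0 < p i) (hq : ∀ i, 0 < q i)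
    (hξ : IsStepSequence P p q ξ) (hsum : ∑ i, (p i + q i) = 1) (n : ℕ)
    (D : Fin 2 → Set (ℤ × ℕ)) :
    P.real {ω | ∀ i, pathState (fun k => ξ k ω) n i ∈ D i} =
      ∑ k ∈ Finset.range (n + 1),
        ((n.choose k : ℝ) * (p 0 + q 0) ^ k * (1 - (p 0 + q 0)) ^ (n - k)) *
        ((axisOp (p 0 / (p 0 + q 0)) (q 0 / (p 0 + q 0)) ^ k) ((D 0).indicator 1) 0 *
        (axisOp (p 1 / (p 1 + q 1)) (q 1 / (p 1 + q 1)) ^ (n - k)) ((D 1).indicator 1) 0) := by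
  have h := measureReal_pathState hξ hsum n {z | ∀ i, z i ∈ D i}
  have hind : ({z | ∀ i, z i ∈ D i} : Set (Fin 2 → ℤ × ℕ)).indicator 1 =
      tensor ((D 0).indicator 1) ((D 1).indicator 1) := by
    classical
    ext z
    simp only [tensor, Set.indicator_apply, Set.mem_ofPred_eq, Fin.forall_fin_two, Pi.one_apply]
    split_ifs <;> simp_all
  rw [hind, planeOp_add_pow_tensor] at h
  refine h.trans (Finset.sum_congr rfl fun k _ => ?_)
  rw [Fin.sum_univ_two] at hsum
  rw [axisOp_pow_eq_smul (p := p 0) (add_pos (hp 0) (hq 0)).ne',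
    axisOp_pow_eq_smul (p := p 1) (q := q 1) (add_pos (hp 1) (hq 1)).ne',
    show 1 - (p 0 + q 0) = p 1 + q 1 by linarith]
  simp only [LinearMap.smul_apply, Pi.smul_apply, Pi.zero_apply, smul_eq_mul]
  ring

/-- Half-open intervals are used because they are differences of two events of the form "at least
`r` returns". -/
lemma axisOp_pow_indicator_Ico {p q : ℝ} {s a b : ℝ} (hs : 0 < s) (hab : a ≤ b) (m : ℕ) :
    (axisOp p q ^ m) (Set.indicator {z | (z.2 : ℝ) / s ∈ Set.Ico a b} 1) 0 =
      returnsTail p q m 0 ⌈a * s⌉₊ - returnsTail p q m 0 ⌈b * s⌉₊ := by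
  have h : Set.indicator {z : ℤ × ℕ | (z.2 : ℝ) / s ∈ Set.Ico a b} (1 : ℤ × ℕ → ℝ) =
      Set.indicator {z | ⌈a * s⌉₊ ≤ z.2} 1 - Set.indicator {z | ⌈b * s⌉₊ ≤ z.2} 1 := by
    ext z
    have h1 : ⌈a * s⌉₊ ≤ z.2 ↔ a ≤ z.2 / s := by rw [Nat.ceil_le, le_div_iff₀ hs]
    have h2 : ⌈b * s⌉₊ ≤ z.2 ↔ b ≤ z.2 / s := by rw [Nat.ceil_le, le_div_iff₀ hs]
    simp only [Set.indicator_apply, Pi.sub_apply, Set.mem_ofPred_eq, Set.mem_Ico, h1, h2,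
      Pi.one_apply, ← not_le]
    by_cases ha : a ≤ z.2 / s <;> by_cases hb : b ≤ z.2 / s <;> simp [ha, hb]
    exact ha (hab.trans hb)
  rw [h, map_sub, Pi.sub_apply, axisOp_pow_indicator, axisOp_pow_indicator]
  simp

lemma scale_pos {p q : ℝ} (hp : 0 < p) (hq : 0 < q) {n : ℕ} (hn : 0 < n) : 0 < scale p q n := by
  rw [scale]
  split_ifs
  · have : (0 : ℝ) < n := by exact_mod_cast hn
    positivity
  · exact one_pos

lemma measureReal_Ico {μ : Measure ℝ} [IsFiniteMeasure μ] {a b : ℝ} (hab : a ≤ b) :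
    μ.real (Set.Ico a b) = μ.real (Set.Ici a) - μ.real (Set.Ici b) := by
  rw [← Set.Ici_sdiff_Ici, measureReal_sdiff (Set.Ici_subset_Ici.2 hab) measurableSet_Ici]

/-- The increment over `[a, b)` of the law of the normalised return count of one axis after `z.2`
moves along it, the normalisation being that of time `z.1`. -/
def returnsIco (p q a b : ℝ) (z : ℕ × ℕ) : ℝ :=
  returnsTail (p / (p + q)) (q / (p + q)) z.2 0 ⌈a * scale p q z.1⌉₊ -
    returnsTail (p / (p + q)) (q / (p + q)) z.2 0 ⌈b * scale p q z.1⌉₊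

lemma tendsto_returnsIco {p q : ℝ} (hp : 0 < p) (hq : 0 < q) {a b : ℝ} (hab : a ≤ b) :
    Tendsto (returnsIco p q a b) (ratioFilter (p + q))
      (𝓝 ((limitLaw p q hp hq).real (Set.Ico a b))) := by
  rw [measureReal_Ico hab]
  exact (tendsto_returnsTail_ratioFilter hp hq a).sub (tendsto_returnsTail_ratioFilter hp hq b)

lemma abs_returnsIco_le {p q : ℝ} (hp : 0 < p) (hq : 0 < q) (a b : ℝ) (z : ℕ × ℕ) :
    |returnsIco p q a b z| ≤ 1 := by
  have hh : 0 < p + q := add_pos hp hq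
  have h1 : p / (p + q) + q / (p + q) = 1 := by rw [← add_div, div_self hh.ne']
  have hp' := (div_pos hp hh).le
  have hq' := (div_pos hq hh).le
  exact abs_sub_le_of_nonneg_of_le (returnsTail_nonneg hp' hq' _ _ _)
    (returnsTail_le_one hp' hq' h1 _ _ _) (returnsTail_nonneg hp' hq' _ _ _)
    (returnsTail_le_one hp' hq' h1 _ _ _)

theorem tendsto_measureReal_returns (hp : ∀ i, 0 < p i) (hq : ∀ i, 0 < q i)
    (hξ : IsStepSequence P p q ξ) (hsum : ∑ i, (p i + q i) = 1) {a b : Fin 2 → ℝ}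
    (hab : ∀ i, a i ≤ b i) :
    Tendsto (fun n : ℕ => P.real
        {ω | ∀ i, (returns (walk ξ) i n ω : ℝ) / scale (p i) (q i) n ∈ Set.Ico (a i) (b i)})
      atTop (𝓝 (∏ i, (limitLaw (p i) (q i) (hp i) (hq i)).real (Set.Ico (a i) (b i)))) := by
  have hsum' := hsum
  rw [Fin.sum_univ_two] at hsum'
  have h0 := add_pos (hp 0) (hq 0)
  have h1 := add_pos (hp 1) (hq 1)
  let h : unitInterval := ⟨p 0 + q 0, h0.le, by linarith⟩
  let g : ℕ × ℕ → ℝ := fun z => returnsIco (p 0) (q 0) (a 0) (b 0) z *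
    returnsIco (p 1) (q 1) (a 1) (b 1) (z.1, z.1 - z.2)
  have hg : Tendsto g (ratioFilter h)
      (𝓝 (∏ i, (limitLaw (p i) (q i) (hp i) (hq i)).real (Set.Ico (a i) (b i)))) := by
    rw [Fin.prod_univ_two]
    refine (tendsto_returnsIco (hp 0) (hq 0) (hab 0)).mul
      ((tendsto_returnsIco (hp 1) (hq 1) (hab 1)).comp ?_)
    rw [show p 1 + q 1 = 1 - (p 0 + q 0) by linarith]
    exact tendsto_sub_ratioFilter (by linarith)
  have hbound : ∀ z, |g z - ∏ i, (limitLaw (p i) (q i) (hp i) (hq i)).real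
      (Set.Ico (a i) (b i))| ≤ 1 + 1 := by
    intro z
    refine (abs_sub _ _).trans (add_le_add ?_ ?_)
    · rw [abs_mul]
      exact mul_le_one₀ (abs_returnsIco_le (hp 0) (hq 0) _ _ _) (abs_nonneg _)
        (abs_returnsIco_le (hp 1) (hq 1) _ _ _)
    · rw [Finset.abs_prod]
      refine Finset.prod_le_one (fun _ _ => abs_nonneg _) fun i _ => ?_
      rw [abs_of_nonneg measureReal_nonneg]
      exact measureReal_le_one
  refine (tendsto_binomial_average h hbound hg).congr' ?_
  filter_upwards [eventually_gt_atTop 0] with n hn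
  have hlaw := measureReal_pathState_pi hp hq hξ hsum n
    fun i => {z | (z.2 : ℝ) / scale (p i) (q i) n ∈ Set.Ico (a i) (b i)}
  simp only [axisOp_pow_indicator_Ico (scale_pos (hp _) (hq _) hn) (hab _), pathState_eq,
    Set.mem_ofPred_eq] at hlaw
  exact hlaw.symm

/-- Weak convergence of laws on `ℝ²` follows from convergence on half-open rectangles. -/
lemma tendsto_of_tendsto_rectangles {ι : Type*} [Fintype ι] {μ : ℕ → ProbabilityMeasure (ι → ℝ)}
    {ν : ProbabilityMeasure (ι → ℝ)}
    (h : ∀ a b : ι → ℝ, (∀ i, a i ≤ b i) →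
      Tendsto (fun n => (μ n : Measure (ι → ℝ)).real (Set.univ.pi fun i => Set.Ico (a i) (b i)))
        atTop (𝓝 ((ν : Measure (ι → ℝ)).real (Set.univ.pi fun i => Set.Ico (a i) (b i))))) :
    Tendsto μ atTop (𝓝 ν) := by
  have hpi := IsPiSystem.pi fun _ : ι => isPiSystem_Ico (id : ℝ → ℝ) id
  have hform : ∀ s ∈ Set.univ.pi '' Set.univ.pi
      (fun _ : ι => {S : Set ℝ | ∃ l u, id l < id u ∧ Set.Ico (id l) (id u) = S}),
      ∃ a b : ι → ℝ, (∀ i, a i ≤ b i) ∧ s = Set.univ.pi fun i => Set.Ico (a i) (b i) := by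
    rintro _ ⟨t, ht, rfl⟩
    choose a b hab ht using fun i => ht i (Set.mem_univ i)
    exact ⟨a, b, fun i => (hab i).le, by congr 1; ext1 i; exact (ht i).symm⟩
  refine hpi.tendsto_probabilityMeasure_of_tendsto_of_mem ?_ ?_ ?_
  · intro s hs
    obtain ⟨a, b, -, rfl⟩ := hform s hs
    exact MeasurableSet.univ_pi fun i => measurableSet_Ico
  · intro u hu x hx
    obtain ⟨ε, hε, hball⟩ := Metric.isOpen_iff.1 hu x hx
    refine ⟨Set.univ.pi fun i => Set.Ico (x i - ε / 2) (x i + ε / 2),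
      ⟨_, fun i _ => ⟨x i - ε / 2, x i + ε / 2, ?_, rfl⟩, rfl⟩, ?_, ?_⟩
    · simp only [id]; linarith
    · exact set_pi_mem_nhds Set.finite_univ fun i _ =>
        Ico_mem_nhds (by linarith) (by linarith)
    · refine fun y hy => hball ((dist_pi_lt_iff hε).2 fun i => ?_)
      have := hy i (Set.mem_univ i)
      rw [Real.dist_eq, abs_lt]
      constructor <;> linarith [this.1, this.2]
  · intro s hs
    obtain ⟨a, b, hab, rfl⟩ := hform s hs
    rw [← NNReal.tendsto_coe]
    exact h a b hab

end

end

end AxisReturns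

/-! ### Conclusion: the limit realised by the coordinates of a product space -/

theorem theorem1p1 {Ω : Type*} [MeasurableSpace Ω] (P : Measure Ω) [IsProbabilityMeasure P]
    (p q : Fin 2 → ℝ) (hp : ∀ i, 0 < p i) (hq : ∀ i, 0 < q i)
    (hsum : ∑ i, (p i + q i) = 1)
    (ξ : ℕ → Ω → Fin 2 → ℤ) (hξ : AxisReturns.IsStepSequence P p q ξ) :
    ∃ (Ω' : Type) (_ : MeasurableSpace Ω') (P' : Measure Ω') (_ : IsProbabilityMeasure P')
      (X : Fin 2 → Ω' → ℝ),
      IndepFun (X 0) (X 1) P' ∧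
      (∀ i, p i = q i → HasLaw (X i) AxisReturns.halfNormal P') ∧
      (∀ i, p i ≠ q i →
        HasLaw (X i)
          (AxisReturns.geometric (AxisReturns.driftRatio (p i) (q i) (hp i) (hq i))) P') ∧
      TendstoInDistribution
        (fun (n : ℕ) (ω : Ω) (i : Fin 2) =>
          (AxisReturns.returns (AxisReturns.walk ξ) i n ω : ℝ) / AxisReturns.scale (p i) (q i) n)
        atTop (fun (ω' : Ω') (i : Fin 2) => X i ω') (fun _ => P) P' := by
  let μ : Fin 2 → Measure ℝ := fun i => AxisReturns.limitLaw (p i) (q i) (hp i) (hq i)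
  have hlaw : ∀ i, HasLaw (fun x : Fin 2 → ℝ => x i) (μ i) (Measure.pi μ) := fun i =>
    (measurePreserving_eval μ i).hasLaw
  have hmeas : ∀ n, Measurable fun (ω : Ω) (i : Fin 2) =>
      (AxisReturns.returns (AxisReturns.walk ξ) i n ω : ℝ) /
        AxisReturns.scale (p i) (q i) n := by
    intro n
    -- The counts are read off the discrete state of the path, on which every function is
    -- measurable.
    have := (Measurable.of_discrete (f := fun (z : Fin 2 → ℤ × ℕ) (i : Fin 2) =>
      ((z i).2 : ℝ) / AxisReturns.scale (p i) (q i) n)).comp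
      (AxisReturns.measurable_pathState hξ.measurable n)
    simpa only [Function.comp_def, AxisReturns.pathState_eq] using this
  refine ⟨Fin 2 → ℝ, inferInstance, Measure.pi μ, inferInstance, fun i x => x i,
    (iIndepFun_pi (X := fun _ => id) fun i => aemeasurable_id).indepFun (by decide),
    fun i h => ?_, fun i h => ?_, fun n => (hmeas n).aemeasurable, aemeasurable_id, ?_⟩
  · simpa only [μ, AxisReturns.limitLaw, if_pos h] using hlaw i
  · simpa only [μ, AxisReturns.limitLaw, if_neg h] using hlaw i
  · refine AxisReturns.tendsto_of_tendsto_rectangles fun a b hab => ?_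
    have hS : MeasurableSet (Set.univ.pi fun i : Fin 2 => Set.Ico (a i) (b i)) :=
      MeasurableSet.univ_pi fun i => measurableSet_Ico
    have h := AxisReturns.tendsto_measureReal_returns hp hq hξ hsum hab
    simp only [ProbabilityMeasure.coe_mk]
    rw [show (fun (x : Fin 2 → ℝ) (i : Fin 2) => x i) = id from rfl, Measure.map_id,
      Measure.real, Measure.pi_pi, ENNReal.toReal_prod]
    refine h.congr fun n => ?_
    rw [map_measureReal_apply (hmeas n) hS]
    congr 1
    ext ω
    simp
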